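/- Let $0\le k\le n$ be integers. The arrangement graph $A(n,k)$ has as vertices the injective maps $\{1,\dots,k\}\to\{1,\dots,n\}$, two of them being adjacent when they agree at exactly $k-1$ points. For a partition $\lambda\vdash m$ (identified with its Young diagram $Y(\lambda)$) let $\chi_\lambda$ be the character of the corresponding irreducible complex representation (the Specht module $S^\lambda$) of the symmetric group $S_m$. For $\lambda\vdash k$ and $\mu\vdash n$ write $\lambda\prec\mu$ if $Y(\mu)$ is obtained from $Y(\lambda)$ by adding at most one box to each column. Let $\tau_n$ be any transposition in $S_n$ and $\tau_k$ any transposition in $S_k$ (if $m\le 1$, so that $S_m$ contains no transposition, let $\tau_m$ be the identity; the corresponding term below is then $0$ because $\binom m2=0$). Then the set of eigenvalues of the adjacency matrix of $A(n,k)$ over $\mathbb{C}$ is exactly the set of numbers $$\binom n2\frac{\chi_\mu(\tau_n)}{\chi_\mu(1)}-\binom k2\frac{\chi_\lambda(\tau_k)}{\chi_\lambda(1)}-\binom{n-k}2,$$ where $\lambda\vdash k$, $\mu\vdash n$ and $\lambda\prec\mu$. -/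

import Mathlib

noncomputable section

namespace Arrangement

/-- The arrangement graph `A(n,k)`: its vertices are the injective maps from a `k`-element set
to an `n`-element set, and two of them are adjacent when they agree on exactly `k - 1` points.
(The condition is written `(number of agreements) + 1 = k`, which avoids subtraction in `ℕ`.) -/
def arrangementGraph (n k : ℕ) : SimpleGraph (Fin k ↪ Fin n) where
  Adj σ τ := (Finset.univ.filter fun i : Fin k => σ i = τ i).card + 1 = k
  symm := ⟨fun σ τ h => by
    have e : (Finset.univ.filter fun i : Fin k => τ i = σ i)
        = Finset.univ.filter fun i : Fin k => σ i = τ i :=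
      Finset.filter_congr fun i _ => eq_comm
    rw [e]
    exact h⟩
  loopless := ⟨fun σ h => by simp at h⟩

instance (n k : ℕ) : DecidableRel (arrangementGraph n k).Adj := fun σ τ =>
  inferInstanceAs
    (Decidable ((Finset.univ.filter fun i : Fin k => σ i = τ i).card + 1 = k))

/-- The relation `λ ≺ μ`: the Young diagram `μ` is obtained from the Young diagram `λ` by adding
at most one box to each column. -/
def AddsAtMostOnePerColumn (lam mu : YoungDiagram) : Prop :=
  lam ≤ mu ∧ ∀ j : ℕ, mu.colLen j ≤ lam.colLen j + 1

/-- The permutation representation of `S_m` on the complex vector space with basis all maps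
`Fin m → ℕ`, where a permutation `g` sends the basis vector `f` to `f ∘ g⁻¹`.  A tabloid with
entries in `Fin m` (a tableau up to permuting the entries inside each row) is the same thing as
the map that sends each entry to the index of its row, so this space contains the usual
permutation module spanned by the tabloids of any given shape. -/
def rowMapRep (m : ℕ) : Representation ℂ (Equiv.Perm (Fin m)) ((Fin m → ℕ) →₀ ℂ) where
  toFun g := Finsupp.lmapDomain ℂ ℂ fun f : Fin m → ℕ => f ∘ ⇑g⁻¹
  map_one' := by
    ext f : 2
    simp
  map_mul' g h := by
    ext f : 2
    simp [Finsupp.mapDomain_single, Function.comp_assoc, Equiv.Perm.coe_mul]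

/-- The tabloid of a tableau `T` of shape `mu`, a bijection from the entries to the boxes; the
first coordinate of a box of a `YoungDiagram` is its row and the second one its column. -/
def tabloid {m : ℕ} {mu : YoungDiagram} (T : Fin m ≃ mu.cells) : (Fin m → ℕ) →₀ ℂ :=
  Finsupp.single (fun i => (T i : ℕ × ℕ).1) 1

/-- The permutations of the entries that preserve each column of the tableau `T`. -/
def columnStabilizer {m : ℕ} {mu : YoungDiagram} (T : Fin m ≃ mu.cells) :
    Finset (Equiv.Perm (Fin m)) :=
  Finset.univ.filter fun σ => ∀ i, (T (σ i) : ℕ × ℕ).2 = (T i : ℕ × ℕ).2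

/-- The polytabloid of a tableau `T`: the sum of `sign σ • σ {T}` over the column stabilizer. -/
def polytabloid {m : ℕ} {mu : YoungDiagram} (T : Fin m ≃ mu.cells) : (Fin m → ℕ) →₀ ℂ :=
  ∑ σ ∈ columnStabilizer T,
    ((Equiv.Perm.sign σ : ℤ) : ℂ) • rowMapRep m σ (tabloid T)

theorem rowMapRep_tabloid {m : ℕ} {mu : YoungDiagram} (g : Equiv.Perm (Fin m))
    (T : Fin m ≃ mu.cells) : rowMapRep m g (tabloid T) = tabloid (g⁻¹.trans T) := by
  simp [rowMapRep, tabloid, Finsupp.mapDomain_single, Function.comp_def]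

theorem rowMapRep_polytabloid {m : ℕ} {mu : YoungDiagram} (g : Equiv.Perm (Fin m))
    (T : Fin m ≃ mu.cells) : rowMapRep m g (polytabloid T) = polytabloid (g⁻¹.trans T) := by
  unfold polytabloid
  rw [map_sum]
  refine Finset.sum_bij' (fun σ _ => g * σ * g⁻¹) (fun σ _ => g⁻¹ * σ * g) ?_ ?_ ?_ ?_ ?_
  · intro σ hσ
    simp only [columnStabilizer, Finset.mem_filter, Finset.mem_univ, true_and] at hσ ⊢
    intro i
    simpa using hσ (g⁻¹ i)
  · intro σ hσ
    simp only [columnStabilizer, Finset.mem_filter, Finset.mem_univ, true_and] at hσ ⊢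
    intro i
    simpa using hσ (g i)
  · intro σ _
    group
  · intro σ _
    group
  · intro σ _
    rw [← rowMapRep_tabloid, map_smul]
    simp only [← Module.End.mul_apply, ← map_mul]
    have hs : Equiv.Perm.sign (g * σ * g⁻¹) = Equiv.Perm.sign σ := by
      rw [map_mul, map_mul, map_inv, mul_right_comm, mul_inv_cancel, one_mul]
    have hg : g * σ * g⁻¹ * g = g * σ := by group
    rw [hs, hg]

/-- The Specht module `S^mu` of a Young diagram `mu` with `m` boxes: the span of the
polytabloids of all tableaux of shape `mu` with entries in `Fin m`. -/
def spechtModule (m : ℕ) (mu : YoungDiagram) : Subrepresentation (rowMapRep m) where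
  toSubmodule := Submodule.span ℂ (Set.range fun T : Fin m ≃ mu.cells => polytabloid T)
  apply_mem_toSubmodule g v hv := by
    induction hv using Submodule.span_induction with
    | mem x hx =>
      obtain ⟨T, rfl⟩ := hx
      exact Submodule.subset_span ⟨g⁻¹.trans T, (rowMapRep_polytabloid g T).symm⟩
    | zero => simp
    | add x y _ _ hx hy => rw [map_add]; exact Submodule.add_mem _ hx hy
    | smul c x _ hx => rw [map_smul]; exact Submodule.smul_mem _ c hx

/-- The character `χ_mu` of the irreducible representation `S^mu` of `S_m`, for `mu` a Young
diagram with `m` boxes. -/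
def spechtCharacter (m : ℕ) (mu : YoungDiagram) (g : Equiv.Perm (Fin m)) : ℂ :=
  Representation.character (k := ℂ) (V := (spechtModule m mu).toSubmodule)
    (spechtModule m mu).toRepresentation g

end Arrangement

end

/-!
The sum of all transpositions of `S_n`, acting on functions on the vertices of `A(n,k)` by permuting
the values, counts the neighbours of a vertex, the transpositions of positions, and the pairs of
values that are not taken (`two_smul_adjMatrix_eq`). So the adjacency operator is the transposition
sum of `S_n`, minus that of `S_k`, minus `(n - k).choose 2`, and the question is on which pairs of
scalars the two commuting transposition sums act.

A highest weight vector for a colouring of the points, a vector that is alternating along each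
colour class ("column") and satisfies the one-box Garnir relations between columns, is an eigenvector
of the transposition sum, and the eigenvalue is the content sum of the diagram with these columns
(`sum_swap_of_mem_highestWeightSpace`). Polytabloids are such vectors, so the content sum is the
scalar on the Specht module, and taking traces it is the character quotient in the claim
(`choose_mul_spechtCharacter_div`).

For a diagram `lam` inside `mu` with at most one more box in each column, pairing a polytabloid of
`mu` with one of `lam` gives a function that is a highest weight vector for both groups, and its value
at the inclusion of the tableaux counts pairs of column permutations, with positive sign
(`rowPairing_polytabloid_ne_zero`). Conversely, each eigenspace is invariant under both groups and so
contains a common highest weight vector (`exists_mem_highestWeightSpace`, applied twice). Such a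
function is nonzero at some vertex that respects the two colourings
(`exists_ne_zero_of_mem_highestWeightSpace`), and as it is alternating, each column of values has at
most one value that this vertex does not take. This is the relation between the two diagrams.
-/

namespace Arrangement

open Finset Equiv

/-! ### Highest weight vectors for a colouring -/

section HighestWeight

variable {ι M M' : Type*} [DecidableEq ι] [AddCommGroup M] [Module ℂ M]
  [AddCommGroup M'] [Module ℂ M']

/-- For a colouring `g` of the points, whose colour classes are thought of as the columns of a
tableau, the vectors that change sign under every transposition inside a column. -/
def alternatingSpace (ρ : Representation ℂ (Perm ι) M) (g : ι → ℕ) : Submodule ℂ M where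
  carrier := {v | ∀ a b, a ≠ b → g a = g b → ρ (swap a b) v = -v}
  zero_mem' := by simp
  add_mem' hv hw a b hab h := by rw [map_add, hv a b hab h, hw a b hab h, neg_add]
  smul_mem' c v hv a b hab h := by rw [map_smul, hv a b hab h, smul_neg]

variable [Fintype ι]

/-- The alternating vectors for the columns of `g` that satisfy in addition the one-box Garnir
relations: exchanging a point with the points of any column further to the left, and summing,
gives the vector back. In the language of `GL`, these are the highest weight vectors. -/
def highestWeightSpace (ρ : Representation ℂ (Perm ι) M) (g : ι → ℕ) : Submodule ℂ M where
  carrier := {v | v ∈ alternatingSpace ρ g ∧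
    ∀ b j, j < g b → ∑ a with g a = j, ρ (swap a b) v = v}
  zero_mem' := ⟨zero_mem _, by simp⟩
  add_mem' hv hw := ⟨add_mem hv.1 hw.1, fun b j h => by
    simp only [map_add, sum_add_distrib, hv.2 b j h, hw.2 b j h]⟩
  smul_mem' c v hv := ⟨Submodule.smul_mem _ c hv.1, fun b j h => by
    simp only [map_smul, ← smul_sum, hv.2 b j h]⟩

/-- The number of points of colour `j`. -/
def columnSize (g : ι → ℕ) (j : ℕ) : ℕ := #{a | g a = j}

/-- The number of points plus twice the sum of the contents (column minus row) of the diagram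
whose columns have the sizes of the colour classes: a point `b` contributes its column `g b` twice
and, summed over a column of size `L`, the rows contribute `L * (L - 1) / 2`. -/
def colourContent (g : ι → ℕ) : ℂ := ∑ b, (2 * (g b : ℂ) + 2 - columnSize g (g b))

theorem sum_swap_of_mem_highestWeightSpace {ρ : Representation ℂ (Perm ι) M} {g : ι → ℕ} {v : M}
    (hv : v ∈ highestWeightSpace ρ g) :
    ∑ a, ∑ b, ρ (swap a b) v = colourContent g • v := by
  obtain ⟨halt, hgar⟩ := hv
  have hlt : ∀ b, ∑ a with g a < g b, ρ (swap a b) v = (g b : ℂ) • v := fun b => by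
    have hmaps : ∀ a ∈ univ.filter fun a => g a < g b, g a ∈ range (g b) := by simp
    rw [← sum_fiberwise_of_maps_to hmaps]
    have : ∀ j ∈ range (g b),
        ∑ a ∈ {a ∈ univ.filter fun a => g a < g b | g a = j}, ρ (swap a b) v = v := by
      intro j hj
      rw [filter_filter]
      conv_rhs => rw [← hgar b j (mem_range.1 hj)]
      refine sum_congr (filter_congr fun a _ => ?_) fun _ _ => rfl
      exact ⟨fun h => h.2, fun h => ⟨h ▸ mem_range.1 hj, h⟩⟩
    rw [sum_congr rfl this, sum_const, card_range, Nat.cast_smul_eq_nsmul]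
  have heq : ∀ b, ∑ a with g a = g b, ρ (swap a b) v
      = (2 - (columnSize g (g b) : ℂ)) • v := fun b => by
    have hb : b ∈ univ.filter fun a => g a = g b := by simp
    have hcard := card_erase_add_one hb
    rw [← add_sum_erase _ _ hb]
    have : ∀ a ∈ (univ.filter fun a => g a = g b).erase b, ρ (swap a b) v = -v := by
      intro a ha
      simp only [mem_erase, mem_filter, mem_univ, true_and] at ha
      exact halt a b ha.1 ha.2
    rw [sum_congr rfl this, sum_const, columnSize, ← hcard, ← Nat.cast_smul_eq_nsmul ℂ]
    rw [swap_self, ← Perm.one_def, map_one, Module.End.one_apply]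
    push_cast
    module
  have hsplit : ∀ b, ∑ a, ρ (swap a b) v = ∑ a with g a < g b, ρ (swap a b) v
      + ∑ a with g a = g b, ρ (swap a b) v + ∑ a with g b < g a, ρ (swap a b) v := fun b => by
    simp only [sum_filter, ← sum_add_distrib]
    refine sum_congr rfl fun a _ => ?_
    rcases lt_trichotomy (g a) (g b) with h | h | h
    · simp [h, h.ne, h.not_gt]
    · simp [h]
    · simp [h, h.ne', h.not_gt]
  have hgt : ∑ b, ∑ a with g b < g a, ρ (swap a b) v
      = ∑ b, ∑ a with g a < g b, ρ (swap a b) v := by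
    simp only [sum_filter]
    rw [sum_comm]
    simp only [swap_comm]
  rw [sum_comm, sum_congr rfl fun b _ => hsplit b, sum_add_distrib, hgt, ← sum_add_distrib,
    colourContent, sum_smul]
  refine sum_congr rfl fun b _ => ?_
  rw [hlt, heq]
  module

theorem map_mem_highestWeightSpace {ρ : Representation ℂ (Perm ι) M}
    {ρ' : Representation ℂ (Perm ι) M'} (φ : M →ₗ[ℂ] M') (hφ : ∀ s v, φ (ρ s v) = ρ' s (φ v))
    {g : ι → ℕ} {v : M} (hv : v ∈ highestWeightSpace ρ g) :
    φ v ∈ highestWeightSpace ρ' g := by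
  refine ⟨fun a b hab h => ?_, fun b j h => ?_⟩
  · rw [← hφ, hv.1 a b hab h, map_neg]
  · simp only [← hφ]
    rw [← map_sum, hv.2 b j h]

/-- The Garnir operator of a point `b` and a column `j` antisymmetrizes over the column enlarged by
`b`: it turns alternating vectors into alternating vectors for the colouring in which `b` is moved
to the column `j`. -/
theorem garnir_mem_alternatingSpace {ρ : Representation ℂ (Perm ι) M} {g : ι → ℕ} {v : M}
    (hv : v ∈ alternatingSpace ρ g) {b : ι} {j : ℕ} (hj : j ≠ g b) :
    v - ∑ a with g a = j, ρ (swap a b) v ∈ alternatingSpace ρ (Function.update g b j) := by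
  -- a transposition that involves the moved point
  have key : ∀ a, g a = j → ρ (swap a b) (v - ∑ a with g a = j, ρ (swap a b) v)
      = -(v - ∑ a with g a = j, ρ (swap a b) v) := by
    intro a ha
    have hmem : a ∈ univ.filter fun a => g a = j := by simp [ha]
    rw [← add_sum_erase _ _ hmem, map_sub, map_add, map_sum, ← Module.End.mul_apply, ← map_mul,
      swap_mul_self, map_one, Module.End.one_apply]
    have : ∀ a' ∈ (univ.filter fun a => g a = j).erase a,
        ρ (swap a b) (ρ (swap a' b) v) = -ρ (swap a' b) v := by
      intro a' ha'
      simp only [mem_erase, mem_filter, mem_univ, true_and] at ha'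
      have hab : a ≠ b := fun h => hj (by rw [← ha, h])
      have : swap a b * swap a' b = swap a' b * swap a a' := by
        rw [mul_swap_eq_swap_mul (swap a' b) a a', swap_apply_left,
          swap_apply_of_ne_of_ne ha'.1.symm hab]
      rw [← Module.End.mul_apply, ← map_mul, this, map_mul, Module.End.mul_apply,
        hv a a' ha'.1.symm (ha.trans ha'.2.symm), map_neg]
    rw [sum_congr rfl this, sum_neg_distrib]
    abel
  intro c d hcd h
  by_cases hc : c = b
  · subst hc
    rw [Function.update_self, Function.update_of_ne hcd.symm] at h
    rw [swap_comm]
    exact key d h.symm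
  by_cases hd : d = b
  · subst hd
    rw [Function.update_self, Function.update_of_ne hcd] at h
    exact key c h
  rw [Function.update_of_ne hc, Function.update_of_ne hd] at h
  -- other transpositions permute the summands of the Garnir operator
  have hsum : ∑ a with g a = j, ρ (swap c d) (ρ (swap a b) v)
      = ∑ a with g a = j, ρ (swap a b) (ρ (swap c d) v) := by
    have hg : ∀ a, g (swap c d a) = g a := fun a => by
      rw [swap_apply_def]
      split_ifs with h1 h2
      · rw [h1, h]
      · rw [h2, h]
      · rfl
    refine sum_nbij' (swap c d) (swap c d) ?_ ?_ ?_ ?_ ?_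
    · simp [hg]
    · simp [hg]
    · simp
    · simp
    · intro a _
      rw [← Module.End.mul_apply, ← map_mul, mul_swap_eq_swap_mul,
        swap_apply_of_ne_of_ne (Ne.symm hc) (Ne.symm hd), map_mul, Module.End.mul_apply]
  rw [map_sub, map_sum, hsum, hv c d hcd h]
  simp only [map_neg, sum_neg_distrib]
  abel

/-- Every nonzero invariant subspace contains a highest weight vector for some colouring whose
columns get shorter from left to right: among all nonzero alternating vectors of the subspace take
one for which the sum of the colours is minimal. The Garnir operators, and exchanging two
neighbouring colours, would otherwise lead to a smaller sum. -/
theorem exists_mem_highestWeightSpace {ρ : Representation ℂ (Perm ι) M} {F : Submodule ℂ M}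
    (hF : F ≠ ⊥) (hinv : ∀ s, ∀ v ∈ F, ρ s v ∈ F) :
    ∃ g : ι → ℕ, Antitone (columnSize g) ∧ ∃ v ∈ F, v ≠ 0 ∧ v ∈ highestWeightSpace ρ g := by
  classical
  let P : ℕ → Prop := fun N =>
    ∃ g : ι → ℕ, ∑ b, g b = N ∧ ∃ v ∈ F, v ≠ 0 ∧ v ∈ alternatingSpace ρ g
  have hP : ∃ N, P N := by
    obtain ⟨v, hvF, hv0⟩ := Submodule.exists_mem_ne_zero_of_ne_bot hF
    refine ⟨_, fun b => Fintype.equivFin ι b, rfl, v, hvF, hv0, fun a b hab h => absurd ?_ hab⟩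
    exact (Fintype.equivFin ι).injective (Fin.ext h)
  obtain ⟨g, hgN, v, hvF, hv0, halt⟩ := Nat.find_spec hP
  have hmin : ∀ g' : ι → ℕ, ∀ w ∈ F, w ≠ 0 → w ∈ alternatingSpace ρ g' →
      ∑ b, g b ≤ ∑ b, g' b := fun g' w hwF hw0 hw =>
    hgN.trans_le (Nat.find_min' hP ⟨g', rfl, w, hwF, hw0, hw⟩)
  refine ⟨g, antitone_nat_of_succ_le fun j => ?_, v, hvF, hv0, halt, fun b j hj => ?_⟩
  · have h := hmin (fun a => swap j (j + 1) (g a)) v hvF hv0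
      fun a b hab h => halt a b hab ((swap j (j + 1)).injective h)
    have hsum : ∑ b, swap j (j + 1) (g b) + columnSize g (j + 1)
        = ∑ b, g b + columnSize g j := by
      simp only [columnSize, card_filter, ← sum_add_distrib]
      refine sum_congr rfl fun b _ => ?_
      rw [swap_apply_def]
      split_ifs <;> omega
    omega
  · by_contra hne
    have hw := hmin _ _ (sub_mem hvF (sum_mem fun a _ => hinv _ _ hvF))
      (sub_ne_zero.2 (Ne.symm hne)) (garnir_mem_alternatingSpace halt hj.ne)
    rw [sum_update_of_mem (mem_univ b), ← add_sum_erase univ g (mem_univ b),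
      sdiff_singleton_eq_erase] at hw
    omega

end HighestWeight

/-! ### Young diagrams and colourings -/

section Diagram

variable {ι : Type*} [Fintype ι]

theorem sum_cells_eq_sum_colour {mu : YoungDiagram} {g : ι → ℕ}
    (h : ∀ j, mu.colLen j = columnSize g j) {R : Type*} [AddCommMonoid R] (F : ℕ → R) :
    ∑ c ∈ mu.cells, F c.2 = ∑ b, F (g b) := by
  classical
  rw [sum_comp F g, sum_comp F Prod.snd]
  have hcell : ∀ j, #{c ∈ mu.cells | c.2 = j} = columnSize g j := fun j => by
    rw [← h, YoungDiagram.colLen_eq_card]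
    rfl
  refine sum_congr ?_ fun j _ => by rw [hcell]; rfl
  ext j
  have h1 : j ∈ mu.cells.image Prod.snd ↔ 0 < #{c ∈ mu.cells | c.2 = j} := by
    rw [card_pos, filter_nonempty_iff, mem_image]
  have h2 : j ∈ univ.image g ↔ 0 < columnSize g j := by
    rw [columnSize, card_pos, filter_nonempty_iff, mem_image]
  rw [h1, h2, hcell]

theorem card_eq_of_colLen {mu : YoungDiagram} {g : ι → ℕ}
    (h : ∀ j, mu.colLen j = columnSize g j) : mu.card = Fintype.card ι := by
  have := sum_cells_eq_sum_colour h fun _ => 1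
  simpa using this

theorem colourContent_eq_of_colLen {κ : Type*} [Fintype κ] {mu : YoungDiagram} {g : ι → ℕ}
    {g' : κ → ℕ} (h : ∀ j, mu.colLen j = columnSize g j)
    (h' : ∀ j, mu.colLen j = columnSize g' j) : colourContent g = colourContent g' := by
  unfold colourContent
  simp only [← h, ← h']
  rw [← sum_cells_eq_sum_colour h fun j => 2 * (j : ℂ) + 2 - mu.colLen j,
    ← sum_cells_eq_sum_colour h' fun j => 2 * (j : ℂ) + 2 - mu.colLen j]

theorem exists_colLen_eq_columnSize {g : ι → ℕ} (hg : Antitone (columnSize g)) :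
    ∃ mu : YoungDiagram, ∀ j, mu.colLen j = columnSize g j := by
  classical
  let cells : Finset (ℕ × ℕ) := univ.biUnion fun b => range (columnSize g (g b)) ×ˢ {g b}
  have hmem : ∀ c : ℕ × ℕ, c ∈ cells ↔ c.1 < columnSize g c.2 := by
    rintro ⟨i, j⟩
    simp only [cells, mem_biUnion, mem_univ, true_and, mem_product, mem_range, mem_singleton]
    constructor
    · rintro ⟨b, hb, rfl⟩
      exact hb
    · intro h
      obtain ⟨b, hb⟩ := card_pos.1 ((Nat.zero_le i).trans_lt h)
      rw [mem_filter] at hb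
      exact ⟨b, hb.2.symm ▸ h, hb.2.symm⟩
  have hlower : IsLowerSet (cells : Set (ℕ × ℕ)) := fun c d hdc hc => by
    rw [mem_coe, hmem] at hc ⊢
    exact (hdc.1.trans_lt hc).trans_le (hg hdc.2)
  refine ⟨⟨cells, hlower⟩, fun j => eq_of_forall_lt_iff fun i => ?_⟩
  · rw [← YoungDiagram.mem_iff_lt_colLen, ← YoungDiagram.mem_cells, hmem]

end Diagram

/-! ### Transposition sums on Specht modules -/

section Specht

variable {m : ℕ} {mu : YoungDiagram}

/-- The colouring of the entries of a tableau by their columns. -/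
def tableauColumn (T : Fin m ≃ mu.cells) (i : Fin m) : ℕ := (T i : ℕ × ℕ).2

theorem colLen_eq_columnSize_tableauColumn (T : Fin m ≃ mu.cells) (j : ℕ) :
    mu.colLen j = columnSize (tableauColumn T) j := by
  rw [YoungDiagram.colLen_eq_card, columnSize]
  symm
  refine card_bij (fun i _ => (T i : ℕ × ℕ)) ?_ ?_ ?_
  · intro i hi
    exact mem_filter.2 ⟨(T i).2, (mem_filter.1 hi).2⟩
  · intro a _ b _ h
    exact T.injective (Subtype.ext h)
  · intro c hc
    obtain ⟨hc, hj⟩ := mem_filter.1 hc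
    exact ⟨T.symm ⟨c, hc⟩, mem_filter.2 ⟨mem_univ _, by simp [tableauColumn, hj]⟩,
      by simp⟩

theorem rowMapRep_apply (s : Perm (Fin m)) (F : (Fin m → ℕ) →₀ ℂ) (f : Fin m → ℕ) :
    rowMapRep m s F f = F (f ∘ s) := by
  have hinj : Function.Injective fun f : Fin m → ℕ => f ∘ ⇑s⁻¹ := fun f f' h => by
    ext i
    simpa using congrFun h (s i)
  have := Finsupp.mapDomain_apply hinj F (f ∘ s)
  have hf : (f ∘ s) ∘ ⇑s⁻¹ = f := by
    ext i
    simp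
  rw [← this, hf]
  rfl

theorem polytabloid_apply (T : Fin m ≃ mu.cells) (f : Fin m → ℕ) :
    polytabloid T f = ∑ σ ∈ columnStabilizer T,
      if (fun i => (T (σ⁻¹ i) : ℕ × ℕ).1) = f then ((Perm.sign σ : ℤ) : ℂ) else 0 := by
  simp only [polytabloid, rowMapRep_tabloid, Finsupp.finsetSum_apply, Finsupp.smul_apply]
  simp only [tabloid, Finsupp.single_apply, smul_eq_mul, mul_ite, mul_one, mul_zero]
  rfl

theorem mem_columnStabilizer {T : Fin m ≃ mu.cells} {σ : Perm (Fin m)} :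
    σ ∈ columnStabilizer T ↔ ∀ i, tableauColumn T (σ i) = tableauColumn T i := by
  simp [columnStabilizer, tableauColumn]

theorem inv_mem_columnStabilizer {T : Fin m ≃ mu.cells} {σ : Perm (Fin m)}
    (h : σ ∈ columnStabilizer T) : σ⁻¹ ∈ columnStabilizer T := by
  rw [mem_columnStabilizer] at h ⊢
  intro i
  simpa using (h (σ⁻¹ i)).symm

/-- The entries of a polytabloid stay in rows that meet their column. -/
theorem lt_colLen_of_polytabloid_apply_ne_zero {T : Fin m ≃ mu.cells} {f : Fin m → ℕ}
    (h : polytabloid T f ≠ 0) (i : Fin m) : f i < mu.colLen (tableauColumn T i) := by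
  rw [polytabloid_apply] at h
  obtain ⟨σ, hσ, hne⟩ := exists_ne_zero_of_sum_ne_zero h
  have hf := (ite_ne_right_iff.1 hne).1
  rw [← hf, ← mem_columnStabilizer.1 (inv_mem_columnStabilizer hσ) i,
    ← YoungDiagram.mem_iff_lt_colLen, ← YoungDiagram.mem_cells]
  exact (T (σ⁻¹ i)).2

theorem polytabloid_apply_self (T : Fin m ≃ mu.cells) :
    polytabloid T (fun i => (T i : ℕ × ℕ).1) = 1 := by
  rw [polytabloid_apply, sum_eq_single 1]
  · simp
  · intro σ hσ hσ1
    refine if_neg fun h => hσ1 (inv_eq_one.1 (Equiv.ext fun i => T.injective (Subtype.ext ?_)))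
    exact Prod.ext (congrFun h i) (mem_columnStabilizer.1 (inv_mem_columnStabilizer hσ) i)
  · intro h
    exact absurd (mem_columnStabilizer.2 fun i => rfl) h

theorem polytabloid_mem_alternatingSpace (T : Fin m ≃ mu.cells) :
    polytabloid T ∈ alternatingSpace (rowMapRep m) (tableauColumn T) := by
  intro a b hab h
  have hcol : ∀ i, tableauColumn T (swap a b i) = tableauColumn T i := fun i => by
    rw [swap_apply_def]
    split_ifs with h1 h2
    · rw [h1, h]
    · rw [h2, h]
    · rfl
  rw [polytabloid, map_sum, ← sum_neg_distrib]
  refine sum_nbij' (swap a b * ·) (swap a b * ·) ?_ ?_ ?_ ?_ ?_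
  · intro σ hσ
    rw [mem_columnStabilizer] at hσ ⊢
    intro i
    rw [Perm.mul_apply, hcol, hσ]
  · intro σ hσ
    rw [mem_columnStabilizer] at hσ ⊢
    intro i
    rw [Perm.mul_apply, hcol, hσ]
  · intro σ _
    simp
  · intro σ _
    simp
  · intro σ _
    rw [map_smul, ← Module.End.mul_apply, ← map_mul, map_mul Perm.sign, Perm.sign_swap hab]
    simp

/-- The Garnir relation holds since both sides have entries in the rows of the left column only:
antisymmetrizing over one entry more than there are rows gives zero. -/
theorem polytabloid_mem_highestWeightSpace (T : Fin m ≃ mu.cells) :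
    polytabloid T ∈ highestWeightSpace (rowMapRep m) (tableauColumn T) := by
  refine ⟨polytabloid_mem_alternatingSpace T, fun b j hj => ?_⟩
  have halt := garnir_mem_alternatingSpace (polytabloid_mem_alternatingSpace T) hj.ne
  rw [eq_comm, ← sub_eq_zero]
  ext f
  by_contra hne
  rw [Finsupp.zero_apply] at hne
  set w := polytabloid T
    - ∑ a with tableauColumn T a = j, rowMapRep m (swap a b) (polytabloid T) with hw
  set C : Finset (Fin m) := insert b (univ.filter fun a => tableauColumn T a = j) with hC
  have hbC : b ∉ univ.filter fun a => tableauColumn T a = j := by simp [hj.ne']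
  have hcard : #C = mu.colLen j + 1 := by
    rw [hC, card_insert_of_notMem hbC, colLen_eq_columnSize_tableauColumn T, columnSize]
  have hupd : ∀ a ∈ C, Function.update (tableauColumn T) b j a = j := by
    intro a ha
    rcases mem_insert.1 ha with rfl | ha
    · simp
    · by_cases hab : a = b
      · rw [hab, Function.update_self]
      · rw [Function.update_of_ne hab, (mem_filter.1 ha).2]
  have hrow : ∀ i ∈ C, f i < mu.colLen j := by
    have hbound : ∀ f' : Fin m → ℕ, polytabloid T f' ≠ 0 → ∀ i ∈ C, f' i < mu.colLen j := by
      intro f' hf' i hi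
      have hlt := lt_colLen_of_polytabloid_apply_ne_zero hf' i
      rcases mem_insert.1 hi with rfl | hi
      · exact hlt.trans_le (mu.colLen_anti _ _ hj.le)
      · rwa [(mem_filter.1 hi).2] at hlt
    by_cases hf : polytabloid T f = 0
    · rw [hw, Finsupp.sub_apply, hf, zero_sub, neg_eq_zero, Finsupp.finsetSum_apply] at hne
      obtain ⟨a, ha, hne⟩ := exists_ne_zero_of_sum_ne_zero hne
      rw [rowMapRep_apply] at hne
      intro i hi
      have hswap : swap a b i ∈ C := by
        rw [swap_apply_def]
        split_ifs
        · exact mem_insert_self _ _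
        · exact mem_insert_of_mem ha
        · exact hi
      simpa using hbound _ hne _ hswap
    · exact hbound f hf
  obtain ⟨a, ha, c, hc, hac, hfac⟩ := exists_ne_map_eq_of_card_lt_of_maps_to
    (by rw [card_range, hcard]; exact Nat.lt_succ_self _ : #(range (mu.colLen j)) < #C)
    (f := f) fun i hi => by simpa using hrow i hi
  have h := DFunLike.congr_fun (halt a c hac ((hupd a ha).trans (hupd c hc).symm)) f
  rw [rowMapRep_apply, Finsupp.neg_apply] at h
  have hf : f ∘ swap a c = f := by
    ext i
    rw [Function.comp_apply, swap_apply_def]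
    split_ifs with h1 h2
    · rw [h1, hfac]
    · rw [h2, hfac]
    · rfl
  rw [hf, self_eq_neg] at h
  exact hne h

theorem nonempty_tableau (h : mu.card = m) : Nonempty (Fin m ≃ mu.cells) :=
  ⟨(Fintype.equivFinOfCardEq (by simpa using h)).symm⟩

/-- If the sum of all transpositions acts by a scalar, then taking the trace expresses the value
of the character at a transposition by this scalar. -/
theorem choose_mul_character_div {V : Type*} [AddCommGroup V] [Module ℂ V] [FiniteDimensional ℂ V]
    [Nontrivial V] (ρ : Representation ℂ (Perm (Fin m)) V) {c : ℂ}
    (hc : ∑ a, ∑ b, ρ (swap a b) = c • LinearMap.id) (τ : Perm (Fin m)) (hτ : 2 ≤ m → τ.IsSwap) :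
    (m.choose 2 : ℂ) * (ρ.character τ / ρ.character 1) = (c - m) / 2 := by
  have hne : ρ.character 1 ≠ 0 := by
    rw [ρ.char_one, Nat.cast_ne_zero]
    exact Module.finrank_pos.ne'
  have htrace := congrArg (LinearMap.trace ℂ V) hc
  rw [map_smul, LinearMap.trace_id, ← ρ.char_one, map_sum, smul_eq_mul] at htrace
  have hterm : ∀ a, LinearMap.trace ℂ V (∑ b, ρ (swap a b))
      = ρ.character 1 + (m - 1 : ℂ) * ρ.character τ := by
    intro a
    rw [map_sum, ← add_sum_erase _ _ (mem_univ a), swap_self]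
    have : ∀ b ∈ univ.erase a, LinearMap.trace ℂ V (ρ (swap a b)) = ρ.character τ := by
      intro b hb
      have hba : b ≠ a := (mem_erase.1 hb).1
      have hm : 2 ≤ m := by
        by_contra hm
        have : Subsingleton (Fin m) := Fin.subsingleton_iff_le_one.2 (by omega)
        exact hba (Subsingleton.elim _ _)
      obtain ⟨c, d, hcd, rfl⟩ := hτ hm
      obtain ⟨s, hs⟩ := isConj_iff.1 (Perm.isConj_swap hcd hba.symm)
      rw [← hs]
      exact ρ.char_conj _ _
    rw [sum_congr rfl this, sum_const, card_erase_of_mem (mem_univ a), card_univ,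
      Fintype.card_fin, nsmul_eq_mul, Nat.cast_sub (Nat.one_le_iff_ne_zero.2 a.pos.ne'),
      Nat.cast_one]
    rfl
  rw [sum_congr rfl fun a _ => hterm a, sum_const, card_univ, Fintype.card_fin,
    nsmul_eq_mul] at htrace
  rw [Nat.cast_choose_two]
  field_simp
  linear_combination htrace

theorem choose_mul_spechtCharacter_div (T : Fin m ≃ mu.cells) (τ : Perm (Fin m))
    (hτ : 2 ≤ m → τ.IsSwap) :
    (m.choose 2 : ℂ) * (spechtCharacter m mu τ / spechtCharacter m mu 1)
      = (colourContent (tableauColumn T) - m) / 2 := by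
  have hfin : FiniteDimensional ℂ (spechtModule m mu).toSubmodule :=
    FiniteDimensional.span_of_finite ℂ (Set.finite_range _)
  have hnontriv : Nontrivial (spechtModule m mu).toSubmodule := by
    have hT : polytabloid T ∈ (spechtModule m mu).toSubmodule := Submodule.subset_span ⟨T, rfl⟩
    refine ⟨⟨polytabloid T, hT⟩, 0, fun h => ?_⟩
    have := polytabloid_apply_self T
    rw [Submodule.mk_eq_zero] at h
    simp [h] at this
  have hscalar : ∀ v ∈ (spechtModule m mu).toSubmodule,
      ∑ a, ∑ b, rowMapRep m (swap a b) v = colourContent (tableauColumn T) • v := by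
    intro v hv
    induction hv using Submodule.span_induction with
    | mem x hx =>
      obtain ⟨T', rfl⟩ := hx
      rw [sum_swap_of_mem_highestWeightSpace (polytabloid_mem_highestWeightSpace T'),
        colourContent_eq_of_colLen (colLen_eq_columnSize_tableauColumn T')
          (colLen_eq_columnSize_tableauColumn T)]
    | zero => simp
    | add x y _ _ hx hy => simp only [map_add, sum_add_distrib, hx, hy, smul_add]
    | smul c x _ hx => simp only [map_smul, ← smul_sum, hx, smul_comm c]
  have hsum : ∑ a, ∑ b, (spechtModule m mu).toRepresentation (swap a b)
      = colourContent (tableauColumn T) • LinearMap.id := by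
    refine LinearMap.ext fun v => Subtype.ext ?_
    rw [LinearMap.smul_apply, LinearMap.id_apply, Submodule.coe_smul, ← hscalar v v.2]
    simp only [LinearMap.sum_apply, AddSubmonoidClass.coe_finsetSum]
    rfl
  have key := choose_mul_character_div (V := (spechtModule m mu).toSubmodule)
    (spechtModule m mu).toRepresentation hsum τ hτ
  unfold spechtCharacter
  exact key

end Specht

/-! ### The adjacency operator as a difference of transposition sums -/

section Graph

variable {n k : ℕ}

/-- The action of the permutations of the `n` values on functions on the vertices of `A(n,k)`. -/
def valueRep (n k : ℕ) : Representation ℂ (Perm (Fin n)) ((Fin k ↪ Fin n) → ℂ) where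
  toFun g := LinearMap.funLeft ℂ ℂ fun σ => σ.trans g⁻¹.toEmbedding
  map_one' := by
    ext u σ
    rfl
  map_mul' g h := by
    refine LinearMap.ext fun u => funext fun σ => congrArg u ?_
    ext p
    simp

/-- The action of the permutations of the `k` positions on functions on the vertices of
`A(n,k)`. -/
def positionRep (n k : ℕ) : Representation ℂ (Perm (Fin k)) ((Fin k ↪ Fin n) → ℂ) where
  toFun s := LinearMap.funLeft ℂ ℂ fun σ => s.toEmbedding.trans σ
  map_one' := by
    ext u σ
    rfl
  map_mul' g h := by
    refine LinearMap.ext fun u => funext fun σ => congrArg u ?_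
    ext p
    simp

theorem valueRep_apply (g : Perm (Fin n)) (u : (Fin k ↪ Fin n) → ℂ) (σ : Fin k ↪ Fin n) :
    valueRep n k g u σ = u (σ.trans g⁻¹.toEmbedding) := rfl

theorem valueRep_swap_apply (a b : Fin n) (u : (Fin k ↪ Fin n) → ℂ) (σ : Fin k ↪ Fin n) :
    valueRep n k (swap a b) u σ = u (σ.trans (swap a b).toEmbedding) := by
  rw [valueRep_apply, swap_inv]

theorem positionRep_apply (s : Perm (Fin k)) (u : (Fin k ↪ Fin n) → ℂ) (σ : Fin k ↪ Fin n) :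
    positionRep n k s u σ = u (s.toEmbedding.trans σ) := rfl

theorem valueRep_positionRep_comm (g : Perm (Fin n)) (s : Perm (Fin k))
    (u : (Fin k ↪ Fin n) → ℂ) :
    valueRep n k g (positionRep n k s u) = positionRep n k s (valueRep n k g u) := rfl

/-- The transposition of two values that are both taken is a transposition of positions. -/
theorem trans_swap_apply_apply (σ : Fin k ↪ Fin n) (p q : Fin k) :
    σ.trans (swap (σ p) (σ q)).toEmbedding = (swap p q).toEmbedding.trans σ := by
  ext r
  simp [σ.injective.swap_apply]

theorem trans_swap_of_notMem_range {σ : Fin k ↪ Fin n} {a b : Fin n} (ha : a ∉ Set.range σ)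
    (hb : b ∉ Set.range σ) : σ.trans (swap a b).toEmbedding = σ := by
  ext r
  have h1 : σ r ≠ a := fun h => ha ⟨r, h⟩
  have h2 : σ r ≠ b := fun h => hb ⟨r, h⟩
  simp [swap_apply_of_ne_of_ne h1 h2]

theorem trans_swap_apply_self (σ : Fin k ↪ Fin n) (p : Fin k) (b : Fin n) :
    σ.trans (swap (σ p) b).toEmbedding p = b := by
  simp

theorem trans_swap_apply_of_ne {σ : Fin k ↪ Fin n} {p r : Fin k} {b : Fin n}
    (hb : b ∉ Set.range σ) (hr : r ≠ p) : σ.trans (swap (σ p) b).toEmbedding r = σ r := by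
  have h2 : σ r ≠ b := fun h => hb ⟨r, h⟩
  simp [swap_apply_of_ne_of_ne (σ.injective.ne hr) h2]

/-- The neighbours of a vertex replace one of its values by a value that is not taken. -/
theorem sum_neighborFinset (u : (Fin k ↪ Fin n) → ℂ) (σ : Fin k ↪ Fin n) :
    ∑ τ ∈ (arrangementGraph n k).neighborFinset σ, u τ
      = ∑ p, ∑ b with b ∉ Set.range σ, u (σ.trans (swap (σ p) b).toEmbedding) := by
  rw [← sum_product']
  symm
  refine sum_bij (fun x _ => σ.trans (swap (σ x.1) x.2).toEmbedding) ?_ ?_ ?_ ?_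
  · rintro ⟨p, b⟩ hx
    have hb : b ∉ Set.range σ := by simpa using hx
    rw [SimpleGraph.mem_neighborFinset]
    change #(univ.filter fun i => σ i = _) + 1 = k
    have : (univ.filter fun i => σ i = σ.trans (swap (σ p) b).toEmbedding i)
        = univ.erase p := by
      ext r
      simp only [mem_filter, mem_univ, true_and, mem_erase, and_true]
      by_cases hr : r = p
      · subst hr
        rw [trans_swap_apply_self]
        exact iff_of_false (fun h => hb ⟨_, h⟩) fun h => h rfl
      · exact iff_of_true (trans_swap_apply_of_ne hb hr).symm hr
    rw [this, card_erase_add_one (mem_univ p), card_univ, Fintype.card_fin]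
  · rintro ⟨p, b⟩ hx ⟨q, c⟩ hy h
    have hb : b ∉ Set.range σ := by simpa using hx
    have hc : c ∉ Set.range σ := by simpa using hy
    have hpq : p = q := by
      by_contra hpq
      have := DFunLike.congr_fun h p
      rw [trans_swap_apply_self, trans_swap_apply_of_ne hc hpq] at this
      exact hb ⟨p, this.symm⟩
    subst hpq
    have := DFunLike.congr_fun h p
    rw [trans_swap_apply_self, trans_swap_apply_self] at this
    exact Prod.ext rfl this
  · intro τ hτ
    rw [SimpleGraph.mem_neighborFinset] at hτ
    replace hτ : #(univ.filter fun i => σ i = τ i) + 1 = k := hτ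
    have hcard : #(univ.filter fun i => ¬ σ i = τ i) = 1 := by
      have := card_filter_add_card_filter_not (s := univ) fun i => σ i = τ i
      rw [card_univ, Fintype.card_fin] at this
      omega
    obtain ⟨p, hp⟩ := card_eq_one.1 hcard
    have hne : ∀ r, σ r ≠ τ r ↔ r = p := fun r => by
      rw [← mem_singleton, ← hp, mem_filter]
      simp
    have hb : τ p ∉ Set.range σ := by
      rintro ⟨r, hr⟩
      by_cases hrp : r = p
      · subst hrp
        exact (hne r).2 rfl hr
      · have h1 : σ r = τ r := not_not.1 fun h => hrp ((hne r).1 h)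
        exact hrp (τ.injective (h1.symm.trans hr))
    refine ⟨(p, τ p), by simpa using hb, ?_⟩
    ext1 r
    by_cases hr : r = p
    · subst hr
      rw [trans_swap_apply_self]
    · rw [trans_swap_apply_of_ne hb hr]
      exact not_not.1 fun h => hr ((hne r).1 h)
  · intros
    rfl

/-- Sort the pairs of values `(a, b)` according to which of them are taken by a vertex: both taken
gives the transpositions of positions, exactly one taken gives the neighbours, and otherwise the
vertex does not change. -/
theorem two_smul_adjMatrix_eq (u : (Fin k ↪ Fin n) → ℂ) :
    (2 : ℂ) • Matrix.toLin' ((arrangementGraph n k).adjMatrix ℂ) u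
      = ∑ a, ∑ b, valueRep n k (swap a b) u - ∑ p, ∑ q, positionRep n k (swap p q) u
        - ((n : ℂ) - k) ^ 2 • u := by
  classical
  ext σ
  have hsplit : ∀ F : Fin n → ℂ,
      ∑ a, F a = ∑ p, F (σ p) + ∑ a with a ∉ Set.range σ, F a := fun F => by
    rw [← sum_filter_add_sum_filter_not univ fun a => a ∈ Set.range σ]
    congr 1
    rw [← sum_map univ σ F]
    refine sum_congr ?_ fun _ _ => rfl
    ext a
    simp
  have hfree : (#(univ.filter fun a => a ∉ Set.range σ) : ℂ) = (n : ℂ) - k := by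
    have := hsplit fun _ => 1
    simp only [sum_const, card_univ, Fintype.card_fin, nsmul_eq_mul, mul_one] at this
    rw [this]
    ring
  simp only [Pi.smul_apply, Pi.sub_apply, Finset.sum_apply, Matrix.toLin'_apply,
    SimpleGraph.adjMatrix_mulVec_apply, valueRep_swap_apply, positionRep_apply, smul_eq_mul]
  rw [sum_neighborFinset, hsplit]
  simp only [hsplit, sum_add_distrib, trans_swap_apply_apply]
  have h1 : ∑ a with a ∉ Set.range σ, ∑ p, u (σ.trans (swap a (σ p)).toEmbedding)
      = ∑ p, ∑ b with b ∉ Set.range σ, u (σ.trans (swap (σ p) b).toEmbedding) := by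
    rw [sum_comm]
    simp only [swap_comm]
  have h2 : ∑ a with a ∉ Set.range σ, ∑ b with b ∉ Set.range σ,
      u (σ.trans (swap a b).toEmbedding) = ((n : ℂ) - k) ^ 2 * u σ := by
    have : ∀ a ∈ univ.filter fun a => a ∉ Set.range σ, ∑ b with b ∉ Set.range σ,
        u (σ.trans (swap a b).toEmbedding) = ((n : ℂ) - k) * u σ := by
      intro a ha
      rw [← hfree, ← nsmul_eq_mul, ← sum_const]
      refine sum_congr rfl fun b hb => ?_
      rw [trans_swap_of_notMem_range (mem_filter.1 ha).2 (mem_filter.1 hb).2]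
    rw [sum_congr rfl this, sum_const, nsmul_eq_mul, hfree]
    ring
  rw [h1, h2]
  ring

theorem adjMatrix_of_mem_highestWeightSpace {g : Fin n → ℕ} {h : Fin k → ℕ}
    {u : (Fin k ↪ Fin n) → ℂ} (hg : u ∈ highestWeightSpace (valueRep n k) g)
    (hh : u ∈ highestWeightSpace (positionRep n k) h) :
    Matrix.toLin' ((arrangementGraph n k).adjMatrix ℂ) u
      = ((colourContent g - colourContent h - ((n : ℂ) - k) ^ 2) / 2) • u := by
  have key := two_smul_adjMatrix_eq u
  rw [sum_swap_of_mem_highestWeightSpace hg, sum_swap_of_mem_highestWeightSpace hh,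
    ← sub_smul, ← sub_smul] at key
  rw [div_eq_inv_mul, mul_smul, ← key, smul_smul]
  norm_num

theorem adjMatrix_valueRep (g : Perm (Fin n)) (u : (Fin k ↪ Fin n) → ℂ) :
    Matrix.toLin' ((arrangementGraph n k).adjMatrix ℂ) (valueRep n k g u)
      = valueRep n k g (Matrix.toLin' ((arrangementGraph n k).adjMatrix ℂ) u) := by
  ext σ
  simp only [Matrix.toLin'_apply, SimpleGraph.adjMatrix_mulVec_apply, valueRep_apply]
  have hadj : ∀ σ τ : Fin k ↪ Fin n, ∀ g : Perm (Fin n), (arrangementGraph n k).Adj σ τ →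
      (arrangementGraph n k).Adj (σ.trans g.toEmbedding) (τ.trans g.toEmbedding) := by
    intro σ τ g h
    refine Eq.trans (congrArg (fun s => #s + 1) (filter_congr fun i _ => ?_)) h
    exact g.injective.eq_iff
  have hinv : ∀ σ : Fin k ↪ Fin n, (σ.trans g⁻¹.toEmbedding).trans g.toEmbedding = σ := fun σ => by
    ext p
    simp
  have hinv' : ∀ σ : Fin k ↪ Fin n, (σ.trans g.toEmbedding).trans g⁻¹.toEmbedding = σ := fun σ => by
    ext p
    simp
  refine sum_bij' (fun τ _ => τ.trans g⁻¹.toEmbedding) (fun τ _ => τ.trans g.toEmbedding)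
    ?_ ?_ ?_ ?_ ?_
  · intro τ hτ
    rw [SimpleGraph.mem_neighborFinset] at hτ ⊢
    exact hadj _ _ g⁻¹ hτ
  · intro τ hτ
    rw [SimpleGraph.mem_neighborFinset] at hτ ⊢
    have := hadj _ _ g hτ
    rwa [hinv] at this
  · intro τ _
    exact hinv τ
  · intro τ _
    exact hinv' τ
  · intros
    rfl

theorem adjMatrix_positionRep (s : Perm (Fin k)) (u : (Fin k ↪ Fin n) → ℂ) :
    Matrix.toLin' ((arrangementGraph n k).adjMatrix ℂ) (positionRep n k s u)
      = positionRep n k s (Matrix.toLin' ((arrangementGraph n k).adjMatrix ℂ) u) := by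
  ext σ
  simp only [Matrix.toLin'_apply, SimpleGraph.adjMatrix_mulVec_apply, positionRep_apply]
  have hadj : ∀ σ τ : Fin k ↪ Fin n, ∀ s : Perm (Fin k), (arrangementGraph n k).Adj σ τ →
      (arrangementGraph n k).Adj (s.toEmbedding.trans σ) (s.toEmbedding.trans τ) := by
    intro σ τ s h
    refine Eq.trans (congrArg (· + 1) ?_) h
    refine card_bij (fun i _ => s i) (by simp) (by simp) fun i hi => ⟨s⁻¹ i, ?_, by simp⟩
    simpa using hi
  have hinv : ∀ σ : Fin k ↪ Fin n, s⁻¹.toEmbedding.trans (s.toEmbedding.trans σ) = σ := fun σ => by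
    ext p
    simp
  have hinv' : ∀ σ : Fin k ↪ Fin n, s.toEmbedding.trans (s⁻¹.toEmbedding.trans σ) = σ := fun σ => by
    ext p
    simp
  refine sum_bij' (fun τ _ => s.toEmbedding.trans τ) (fun τ _ => s⁻¹.toEmbedding.trans τ)
    ?_ ?_ ?_ ?_ ?_
  · intro τ hτ
    rw [SimpleGraph.mem_neighborFinset] at hτ ⊢
    exact hadj _ _ s hτ
  · intro τ hτ
    rw [SimpleGraph.mem_neighborFinset] at hτ ⊢
    have := hadj _ _ s⁻¹ hτ
    rwa [hinv] at this
  · intro τ _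
    exact hinv τ
  · intro τ _
    exact hinv' τ
  · intros
    rfl

end Graph

/-! ### Weights of common highest weight vectors -/

section Weights

variable {n k : ℕ}

/-- Exchanging values moves a vertex closer to one that respects the colours. The Garnir relations
therefore force a common highest weight vector to be nonzero at a vertex that maps each column of
positions into the column of values of the same colour: at a vertex where the number of positions
whose colour is respected is maximal, all further terms of a Garnir relation that involves a
position with the wrong colour either vanish or repeat the original value with a sign. -/
theorem exists_ne_zero_of_mem_highestWeightSpace {g : Fin n → ℕ} {h : Fin k → ℕ}
    {u : (Fin k ↪ Fin n) → ℂ} (hg : u ∈ highestWeightSpace (valueRep n k) g)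
    (hh : u ∈ highestWeightSpace (positionRep n k) h) (hu : u ≠ 0) :
    ∃ σ, u σ ≠ 0 ∧ ∀ p, g (σ p) = h p := by
  classical
  let D : (Fin k ↪ Fin n) → ℕ := fun σ => #{p | g (σ p) = h p}
  obtain ⟨σ₀, hσ₀⟩ := Function.ne_iff.1 hu
  obtain ⟨σ, hσ, hmax⟩ := exists_max_image (univ.filter fun σ => u σ ≠ 0) D
    ⟨σ₀, by simpa using hσ₀⟩
  replace hσ : u σ ≠ 0 := (mem_filter.1 hσ).2
  have hzero : ∀ τ, D σ < D τ → u τ = 0 := fun τ hτ => by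
    by_contra hne
    exact (hmax τ (by simpa using hne)).not_gt hτ
  -- correcting the colour of one position without spoiling a correct one increases `D`
  have hD : ∀ (τ : Fin k ↪ Fin n) (p : Fin k), g (σ p) ≠ h p → g (τ p) = h p →
      (∀ r, g (σ r) = h r → g (τ r) = h r) → D σ < D τ := by
    intro τ p hp hp' hr
    refine card_lt_card ((ssubset_iff_of_subset fun r => ?_).2 ⟨p, ?_, ?_⟩)
    · simpa using hr r
    · simpa using hp'
    · simpa using hp
  -- a Garnir relation would thus say that `u σ` is a sum of copies of `-u σ`
  have hcontra : ∀ N : ℕ, u σ ≠ ∑ _i ∈ range N, -u σ := fun N heq => by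
    rw [sum_const, card_range, nsmul_eq_mul] at heq
    have : ((N + 1 : ℕ) : ℂ) * u σ = 0 := by
      push_cast
      linear_combination heq
    rcases mul_eq_zero.1 this with h0 | h0
    · exact Nat.cast_ne_zero.2 N.succ_ne_zero h0
    · exact hσ h0
  have hrelation : ∀ {α : Type} (s : Finset α) (F : α → ℂ), (∀ a ∈ s, F a = -u σ ∨ F a = 0) →
      ∑ a ∈ s, F a ≠ u σ := by
    intro α s F hF heq
    refine hcontra #(s.filter fun a => F a = -u σ) ?_
    conv_lhs => rw [← heq]
    rw [sum_const, card_range, ← sum_const,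
      ← sum_filter_add_sum_filter_not s fun a => F a = -u σ]
    rw [sum_congr rfl fun a ha => (mem_filter.1 ha).2, add_eq_left]
    exact sum_eq_zero fun a ha =>
      (hF a (mem_filter.1 ha).1).resolve_left (mem_filter.1 ha).2
  refine ⟨σ, hσ, fun p => ?_⟩
  by_contra hp
  rcases lt_or_gt_of_ne hp with hlt | hlt
  · have hrel := congrFun (hh.2 p _ hlt) σ
    rw [Finset.sum_apply] at hrel
    refine hrelation _ _ (fun q hq => ?_) hrel
    replace hq : h q = g (σ p) := (mem_filter.1 hq).2
    have hqp : q ≠ p := fun e => hp (by rw [← hq, e])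
    rw [positionRep_apply]
    by_cases hgq : g (σ q) = g (σ p)
    · left
      rw [← trans_swap_apply_apply, ← valueRep_swap_apply _ _ u σ,
        hg.1 _ _ (σ.injective.ne hqp) hgq, Pi.neg_apply]
    · right
      refine hzero _ (hD _ q (fun e => hgq (e.trans hq)) (by simp [hq]) fun r hr => ?_)
      have hrp : r ≠ p := fun e => hp (e ▸ hr)
      have hrq : r ≠ q := fun e => hgq ((e ▸ hr).trans hq)
      simpa [swap_apply_of_ne_of_ne hrq hrp] using hr
  · have hrel := congrFun (hg.2 (σ p) _ hlt) σ
    rw [Finset.sum_apply] at hrel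
    refine hrelation _ _ (fun a ha => ?_) hrel
    replace ha : g a = h p := (mem_filter.1 ha).2
    rw [valueRep_swap_apply]
    by_cases haσ : a ∈ Set.range σ
    · obtain ⟨q, rfl⟩ := haσ
      have hqp : q ≠ p := fun e => hp (by rw [← ha, e])
      rw [trans_swap_apply_apply]
      by_cases hhq : h q = h p
      · left
        rw [← positionRep_apply _ u σ, hh.1 _ _ hqp hhq, Pi.neg_apply]
      · right
        refine hzero _ (hD _ p hp (by simp [ha]) fun r hr => ?_)
        have hrp : r ≠ p := fun e => hp (e ▸ hr)
        have hrq : r ≠ q := fun e => hhq ((e ▸ hr).symm.trans ha)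
        simpa [swap_apply_of_ne_of_ne hrq hrp] using hr
    · right
      rw [swap_comm]
      refine hzero _ (hD _ p hp (by rw [trans_swap_apply_self, ha]) fun r hr => ?_)
      have hrp : r ≠ p := fun e => hp (e ▸ hr)
      rwa [trans_swap_apply_of_ne haσ hrp]

/-- Two values of the same colour that are not taken could be exchanged without an effect on the
vertex, so each column of values has at most one of them. -/
theorem columnSize_le_of_mem_highestWeightSpace {g : Fin n → ℕ} {h : Fin k → ℕ}
    {u : (Fin k ↪ Fin n) → ℂ} (hg : u ∈ highestWeightSpace (valueRep n k) g)
    (hh : u ∈ highestWeightSpace (positionRep n k) h) (hu : u ≠ 0) (j : ℕ) :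
    columnSize h j ≤ columnSize g j ∧ columnSize g j ≤ columnSize h j + 1 := by
  classical
  obtain ⟨σ, hσ, hcol⟩ := exists_ne_zero_of_mem_highestWeightSpace hg hh hu
  have hmap : (univ.filter fun p => h p = j).map σ
      = univ.filter fun a => g a = j ∧ a ∈ Set.range σ := by
    ext a
    simp only [mem_map, mem_filter, mem_univ, true_and, Set.mem_range]
    constructor
    · rintro ⟨p, hp, rfl⟩
      exact ⟨(hcol p).trans hp, p, rfl⟩
    · rintro ⟨ha, p, rfl⟩
      exact ⟨p, (hcol p).symm.trans ha, rfl⟩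
  have hsize : columnSize h j + #(univ.filter fun a => g a = j ∧ a ∉ Set.range σ)
      = columnSize g j := by
    rw [columnSize, ← card_map σ, hmap, columnSize,
      ← card_filter_add_card_filter_not (s := univ.filter fun a => g a = j)
        fun a => a ∈ Set.range σ, filter_filter, filter_filter]
  have hone : #(univ.filter fun a => g a = j ∧ a ∉ Set.range σ) ≤ 1 := by
    refine card_le_one.2 fun a ha b hb => ?_
    obtain ⟨hga, ha⟩ := (mem_filter.1 ha).2
    obtain ⟨hgb, hb⟩ := (mem_filter.1 hb).2
    by_contra hab
    have := congrFun (hg.1 a b hab (hga.trans hgb.symm)) σ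
    rw [valueRep_swap_apply, trans_swap_of_notMem_range ha hb, Pi.neg_apply, self_eq_neg] at this
    exact hσ this
  omega

end Weights

/-! ### Construction of eigenvectors -/

section Pairing

variable {n k : ℕ}

/-- The function on the vertices of `A(n,k)` obtained from two combinations of row maps, by pairing
a row map of the values with its pullback to the positions: it is the bilinear extension of
`(f, f') ↦ (σ ↦ if f ∘ σ = f' then 1 else 0)`. -/
noncomputable def rowPairing (n k : ℕ) :
    ((Fin n → ℕ) →₀ ℂ) →ₗ[ℂ] ((Fin k → ℕ) →₀ ℂ) →ₗ[ℂ] ((Fin k ↪ Fin n) → ℂ) :=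
  Finsupp.lsum ℂ fun f => LinearMap.toSpanSingleton ℂ _
    (LinearMap.pi fun σ => Finsupp.lapply (f ∘ σ))

theorem rowPairing_apply (F : (Fin n → ℕ) →₀ ℂ) (H : (Fin k → ℕ) →₀ ℂ) (σ : Fin k ↪ Fin n) :
    rowPairing n k F H σ = F.sum fun f c => c * H (f ∘ σ) := by
  simp [rowPairing, Finsupp.sum, LinearMap.sum_apply, Finset.sum_apply]

theorem rowPairing_rowMapRep_left (g : Perm (Fin n)) (F : (Fin n → ℕ) →₀ ℂ)
    (H : (Fin k → ℕ) →₀ ℂ) :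
    rowPairing n k (rowMapRep n g F) H = valueRep n k g (rowPairing n k F H) := by
  ext σ
  rw [valueRep_apply, rowPairing_apply, rowPairing_apply]
  refine (Finsupp.sum_mapDomain_index (by simp) (by intros; ring)).trans ?_
  rfl

theorem rowPairing_rowMapRep_right (s : Perm (Fin k)) (F : (Fin n → ℕ) →₀ ℂ)
    (H : (Fin k → ℕ) →₀ ℂ) :
    rowPairing n k F (rowMapRep k s H) = positionRep n k s (rowPairing n k F H) := by
  ext σ
  rw [positionRep_apply, rowPairing_apply, rowPairing_apply]
  simp only [rowMapRep_apply]
  rfl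

theorem exists_tableaux {lam mu : YoungDiagram} (hlam : lam.card = k) (hmu : mu.card = n)
    (hle : lam ≤ mu) : ∃ (T : Fin n ≃ mu.cells) (S : Fin k ≃ lam.cells) (σ : Fin k ↪ Fin n),
      ∀ p, (T (σ p) : ℕ × ℕ) = S p := by
  obtain ⟨T⟩ := nonempty_tableau hmu
  obtain ⟨S⟩ := nonempty_tableau hlam
  let incl : lam.cells ↪ mu.cells := Function.Embedding.subtypeMap (.refl _) fun _ h => hle h
  refine ⟨T, S, S.toEmbedding.trans (incl.trans T.symm.toEmbedding), fun p => ?_⟩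
  exact congrArg Subtype.val (T.apply_symm_apply (incl (S p)))

/-- The value of the pairing of two polytabloids at the inclusion of one tableau in the other. A
pair of column permutations contributes only if the permutation of the large tableau extends that
of the small one, and then the signs cancel, so the value is a positive integer. -/
theorem rowPairing_polytabloid_ne_zero {lam mu : YoungDiagram}
    (hadd : AddsAtMostOnePerColumn lam mu) {T : Fin n ≃ mu.cells} {S : Fin k ≃ lam.cells}
    {σ : Fin k ↪ Fin n} (hσ : ∀ p, (T (σ p) : ℕ × ℕ) = S p) :
    rowPairing n k (polytabloid T) (polytabloid S) ≠ 0 := by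
  classical
  have hcol : ∀ p, tableauColumn T (σ p) = tableauColumn S p := fun p => by
    rw [tableauColumn, hσ, tableauColumn]
  -- a column of the large tableau has at most one entry outside the small tableau
  have hout : ∀ a b, a ∉ Set.range σ → b ∉ Set.range σ →
      tableauColumn T a = tableauColumn T b → a = b := by
    have hrow : ∀ a, a ∉ Set.range σ → (T a : ℕ × ℕ).1 = lam.colLen (tableauColumn T a) := by
      intro a ha
      refine le_antisymm ?_ (le_of_not_gt fun hlt => ha ?_)
      · have h1 : (T a : ℕ × ℕ).1 < mu.colLen (tableauColumn T a) :=
          YoungDiagram.mem_iff_lt_colLen.1 (T a).2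
        exact Nat.lt_succ_iff.1 (h1.trans_le (hadd.2 _))
      · have hmem : (T a : ℕ × ℕ) ∈ lam.cells := YoungDiagram.mem_iff_lt_colLen.2 hlt
        refine ⟨S.symm ⟨T a, hmem⟩, T.injective (Subtype.ext ?_)⟩
        rw [hσ, apply_symm_apply]
    intro a b ha hb hab
    refine T.injective (Subtype.ext (Prod.ext ?_ hab))
    rw [hrow a ha, hrow b hb, hab]
  have hsign : ∀ π ∈ columnStabilizer T, ∀ ρ ∈ columnStabilizer S,
      (fun i => (S (ρ⁻¹ i) : ℕ × ℕ).1) = (fun i => (T (π⁻¹ i) : ℕ × ℕ).1) ∘ σ →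
      Perm.sign π = Perm.sign ρ := by
    intro π hπ ρ hρ heq
    replace hπ := mem_columnStabilizer.1 (inv_mem_columnStabilizer hπ)
    replace hρ := mem_columnStabilizer.1 (inv_mem_columnStabilizer hρ)
    have hin : ∀ p, π⁻¹ (σ p) = σ (ρ⁻¹ p) := fun p => by
      refine T.injective (Subtype.ext (Prod.ext ?_ ?_))
      · rw [hσ]
        exact (congrFun heq p).symm
      · change tableauColumn T _ = tableauColumn T _
        rw [hπ, hcol, hcol, hρ]
    have hext : π⁻¹ = ρ⁻¹.viaFintypeEmbedding σ := by
      refine Equiv.ext fun a => ?_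
      by_cases ha : a ∈ Set.range σ
      · obtain ⟨p, rfl⟩ := ha
        rw [hin, Perm.viaFintypeEmbedding_apply_image]
      · rw [Perm.viaFintypeEmbedding_apply_notMem_range _ _ ha]
        refine hout _ _ (fun ⟨q, hq⟩ => ha ⟨ρ q, ?_⟩) ha (hπ a)
        have := hin (ρ q)
        rw [Perm.inv_def ρ, symm_apply_apply, hq] at this
        exact π⁻¹.injective this
    rw [← Perm.sign_inv π, hext, Perm.viaFintypeEmbedding_sign, Perm.sign_inv]
  have hvalue : rowPairing n k (polytabloid T) (polytabloid S) σ
      = ((∑ π ∈ columnStabilizer T, ∑ ρ ∈ columnStabilizer S,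
        if (fun i => (S (ρ⁻¹ i) : ℕ × ℕ).1) = (fun i => (T (π⁻¹ i) : ℕ × ℕ).1) ∘ σ
          then 1 else 0 : ℕ) : ℂ) := by
    have htab : ∀ (T' : Fin n ≃ mu.cells) (H : (Fin k → ℕ) →₀ ℂ),
        rowPairing n k (tabloid T') H σ = H ((fun i => (T' i : ℕ × ℕ).1) ∘ σ) := fun T' H => by
      rw [rowPairing_apply, tabloid, Finsupp.sum_single_index (zero_mul _), one_mul]
    conv_lhs => rw [polytabloid]
    simp only [map_sum, map_smul, LinearMap.sum_apply, LinearMap.smul_apply, Finset.sum_apply,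
      Pi.smul_apply, rowMapRep_tabloid, htab, polytabloid_apply, smul_eq_mul, mul_sum]
    push_cast
    refine sum_congr rfl fun π hπ => sum_congr rfl fun ρ hρ => ?_
    rw [mul_ite, mul_zero]
    refine ite_congr rfl (fun heq => ?_) fun _ => rfl
    rw [hsign π hπ ρ hρ heq, ← Int.cast_mul, Int.units_coe_mul_self, Int.cast_one]
  intro h0
  rw [h0, Pi.zero_apply, eq_comm, Nat.cast_eq_zero, sum_eq_zero_iff] at hvalue
  have h1 := sum_eq_zero_iff.1 (hvalue 1 (mem_columnStabilizer.2 fun _ => rfl)) 1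
    (mem_columnStabilizer.2 fun _ => rfl)
  refine absurd h1 ?_
  rw [if_pos]
  · exact one_ne_zero
  · ext p
    simp [hσ]

end Pairing

/-! ### The spectrum -/

section Spectrum

variable {n k : ℕ} {lam mu : YoungDiagram}

theorem spechtCharacter_formula (hkn : k ≤ n) {τn : Perm (Fin n)} (hτn : 2 ≤ n → τn.IsSwap)
    {τk : Perm (Fin k)} (hτk : 2 ≤ k → τk.IsSwap) (T : Fin n ≃ mu.cells) (S : Fin k ≃ lam.cells) :
    (n.choose 2 : ℂ) * (spechtCharacter n mu τn / spechtCharacter n mu 1)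
        - (k.choose 2 : ℂ) * (spechtCharacter k lam τk / spechtCharacter k lam 1)
        - ((n - k).choose 2 : ℂ)
      = (colourContent (tableauColumn T) - colourContent (tableauColumn S)
        - ((n : ℂ) - k) ^ 2) / 2 := by
  rw [choose_mul_spechtCharacter_div T τn hτn, choose_mul_spechtCharacter_div S τk hτk,
    Nat.cast_choose_two, Nat.cast_sub hkn]
  ring

theorem hasEigenvalue_of_addsAtMostOnePerColumn (hlam : lam.card = k) (hmu : mu.card = n)
    (hadd : AddsAtMostOnePerColumn lam mu) (T : Fin n ≃ mu.cells) (S : Fin k ≃ lam.cells) :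
    Module.End.HasEigenvalue (Matrix.toLin' ((arrangementGraph n k).adjMatrix ℂ))
      ((colourContent (tableauColumn T) - colourContent (tableauColumn S)
        - ((n : ℂ) - k) ^ 2) / 2) := by
  obtain ⟨T', S', σ, hσ⟩ := exists_tableaux hlam hmu hadd.1
  rw [colourContent_eq_of_colLen (colLen_eq_columnSize_tableauColumn T)
      (colLen_eq_columnSize_tableauColumn T'),
    colourContent_eq_of_colLen (colLen_eq_columnSize_tableauColumn S)
      (colLen_eq_columnSize_tableauColumn S')]
  refine Module.End.hasEigenvalue_of_hasEigenvector (Module.End.hasEigenvector_iff.2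
    ⟨Module.End.mem_eigenspace_iff.2 (adjMatrix_of_mem_highestWeightSpace ?_ ?_),
      rowPairing_polytabloid_ne_zero hadd hσ⟩)
  · exact map_mem_highestWeightSpace ((rowPairing n k).flip (polytabloid S'))
      (fun g F => rowPairing_rowMapRep_left g F _) (polytabloid_mem_highestWeightSpace T')
  · exact map_mem_highestWeightSpace (rowPairing n k (polytabloid T'))
      (fun s H => rowPairing_rowMapRep_right s _ H) (polytabloid_mem_highestWeightSpace S')

/-- An eigenspace is invariant under both symmetric groups, which commute, so it contains a common
highest weight vector. -/
theorem exists_diagrams_of_hasEigenvalue {x : ℂ}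
    (hx : Module.End.HasEigenvalue (Matrix.toLin' ((arrangementGraph n k).adjMatrix ℂ)) x) :
    ∃ lam mu : YoungDiagram, lam.card = k ∧ mu.card = n ∧ AddsAtMostOnePerColumn lam mu ∧
      ∀ (T : Fin n ≃ mu.cells) (S : Fin k ≃ lam.cells),
        x = (colourContent (tableauColumn T) - colourContent (tableauColumn S)
          - ((n : ℂ) - k) ^ 2) / 2 := by
  set A := Matrix.toLin' ((arrangementGraph n k).adjMatrix ℂ) with hA
  have hvalue : ∀ g, ∀ v ∈ Module.End.eigenspace A x,
      valueRep n k g v ∈ Module.End.eigenspace A x := by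
    intro g v hv
    rw [Module.End.mem_eigenspace_iff] at hv ⊢
    rw [hA, adjMatrix_valueRep, ← hA, hv, map_smul]
  obtain ⟨g, hganti, w, hwE, hw0, hwg⟩ := exists_mem_highestWeightSpace hx hvalue
  have hne : Module.End.eigenspace A x ⊓ highestWeightSpace (valueRep n k) g ≠ ⊥ :=
    (Submodule.ne_bot_iff _).2 ⟨w, ⟨hwE, hwg⟩, hw0⟩
  have hposition : ∀ s, ∀ v ∈ Module.End.eigenspace A x ⊓ highestWeightSpace (valueRep n k) g,
      positionRep n k s v ∈ Module.End.eigenspace A x ⊓ highestWeightSpace (valueRep n k) g := by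
    rintro s v ⟨hv, hvg⟩
    refine ⟨?_, map_mem_highestWeightSpace (positionRep n k s)
      (fun g u => (valueRep_positionRep_comm g s u).symm) hvg⟩
    rw [SetLike.mem_coe, Module.End.mem_eigenspace_iff] at hv ⊢
    rw [hA, adjMatrix_positionRep, ← hA, hv, map_smul]
  obtain ⟨h, hhanti, u, ⟨huE, hug⟩, hu0, huh⟩ := exists_mem_highestWeightSpace hne hposition
  obtain ⟨mu, hmu⟩ := exists_colLen_eq_columnSize hganti
  obtain ⟨lam, hlam⟩ := exists_colLen_eq_columnSize hhanti
  have hsize := columnSize_le_of_mem_highestWeightSpace hug huh hu0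
  refine ⟨lam, mu, by simpa using card_eq_of_colLen hlam, by simpa using card_eq_of_colLen hmu,
    ⟨fun c hc => ?_, fun j => ?_⟩, fun T S => ?_⟩
  · rw [YoungDiagram.mem_iff_lt_colLen] at hc ⊢
    rw [hlam] at hc
    rw [hmu]
    exact hc.trans_le (hsize c.2).1
  · rw [hmu, hlam]
    exact (hsize j).2
  · rw [SetLike.mem_coe, Module.End.mem_eigenspace_iff, hA,
      adjMatrix_of_mem_highestWeightSpace hug huh] at huE
    rw [← smul_left_injective ℂ hu0 huE,
      colourContent_eq_of_colLen (colLen_eq_columnSize_tableauColumn T) hmu,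
      colourContent_eq_of_colLen (colLen_eq_columnSize_tableauColumn S) hlam]

end Spectrum

end Arrangement

theorem theorem3p5 (n k : ℕ) (hkn : k ≤ n)
    (τn : Equiv.Perm (Fin n)) (hτn : 2 ≤ n → τn.IsSwap)
    (τk : Equiv.Perm (Fin k)) (hτk : 2 ≤ k → τk.IsSwap) (x : ℂ) :
    Module.End.HasEigenvalue
        (Matrix.toLin' ((Arrangement.arrangementGraph n k).adjMatrix ℂ)) x ↔
      ∃ lam mu : YoungDiagram, lam.card = k ∧ mu.card = n ∧
        Arrangement.AddsAtMostOnePerColumn lam mu ∧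
        x = (n.choose 2 : ℂ) *
              (Arrangement.spechtCharacter n mu τn / Arrangement.spechtCharacter n mu 1)
            - (k.choose 2 : ℂ) *
              (Arrangement.spechtCharacter k lam τk / Arrangement.spechtCharacter k lam 1)
            - ((n - k).choose 2 : ℂ) := by
  constructor
  · intro hx
    obtain ⟨lam, mu, hlam, hmu, hadd, hTS⟩ :=
      Arrangement.exists_diagrams_of_hasEigenvalue hx
    obtain ⟨T⟩ := Arrangement.nonempty_tableau hmu
    obtain ⟨S⟩ := Arrangement.nonempty_tableau hlam
    exact ⟨lam, mu, hlam, hmu, hadd,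
      (hTS T S).trans (Arrangement.spechtCharacter_formula hkn hτn hτk T S).symm⟩
  · rintro ⟨lam, mu, hlam, hmu, hadd, rfl⟩
    obtain ⟨T⟩ := Arrangement.nonempty_tableau hmu
    obtain ⟨S⟩ := Arrangement.nonempty_tableau hlam
    rw [Arrangement.spechtCharacter_formula hkn hτn hτk T S]
    exact Arrangement.hasEigenvalue_of_addsAtMostOnePerColumn hlam hmu hadd T S
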